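/- Let $X$ be a zero-dimensional compact metrizable space, $d_X$ a metric inducing its topology, $\Gamma$ a discrete group, and $h:\Gamma\to\mathrm{Homeo}(X)$, $s\mapsto h_s$, a continuous action (a group homomorphism). Let $\alpha_s(f)=f\circ h_s^{-1}$ be the induced action on the C*-algebra $C(X)$ of continuous complex-valued functions, and $\hat\alpha_s=K_0(\alpha_s)$ the induced action on the ordered abelian group $K_0(C(X))$ with positive cone $K_0(C(X))^+=\{[p]: p \text{ a projection in } M_n(C(X)),\ n\in\mathbb N\}$ and order unit $[1]$. For $S\subset K_0(C(X))$ and $F\subset\Gamma$ put $S_F=\{\hat\alpha_t(x): x\in S,\ t\in F\cup\{e\}\}$. Let $\mathbb Z^d$ carry the positive cone $(\mathbb Z_{\ge 0})^d$ and the order unit $(1,\dots,1)$, and let $\mathrm{OAut}(\mathbb Z^d)$ be the group of all group automorphisms $\tau$ of $\mathbb Z^d$ with $\tau((\mathbb Z_{\ge 0})^d)=(\mathbb Z_{\ge 0})^d$ and $\tau(1,\dots,1)=(1,\dots,1)$. Then the following statements are equivalent. 1. The action is residually finite: for every $\varepsilon>0$ and every finite $F\subset\Gamma$ there are a finite set $E$,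 an action $k:\Gamma\to\mathrm{Perm}(E)$ and a map $\zeta:E\to X$ such that $d_X(\zeta(k_s(z)),h_s(\zeta(z)))<\varepsilon$ for all $s\in F$ and $z\in E$, and for every $x\in X$ there is $z\in E$ with $d_X(x,\zeta(z))<\varepsilon$. 2. For all finite subsets $S\subset K_0(C(X))^+$ and $F\subset\Gamma$ there are $d\in\mathbb N$, a group homomorphism $\sigma:\Gamma\to\mathrm{OAut}(\mathbb Z^d)$, and a group homomorphism $\beta:K_0(C(X))\to\mathbb Z^d$ with $\beta(K_0(C(X))^+)\subset(\mathbb Z_{\ge 0})^d$ and $\beta([1])=(1,\dots,1)$ such that (a) $\beta(\hat\alpha_t(g))=\sigma_t(\beta(g))$ for all $g\in S$ and $t\in F$; (b) $\beta(g)\ne 0$ for every $0\ne g\in S$. 3. For all finite subsets $S\subset K_0(C(X))^+$ and $F\subset\Gamma$ there are $d\in\mathbb N$, a subgroup $H\le K_0(C(X))$, a group homomorphism $\sigma:\Gamma\to\mathrm{OAut}(\mathbb Z^d)$, and a group homomorphism $\beta:H\to\mathbb Z^d$ that is positive, i.e. $\beta(H\cap K_0(C(X))^+)\subset(\mathbb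 Z_{\ge 0})^d$, such that (a) $[1]\in H$, $S_F\subset H$, and $\beta([1])=(1,\dots,1)$; (b) $\beta(\hat\alpha_t(g))=\sigma_t(\beta(g))$ for all $g\in S$ and $t\in F$; (c) $\beta(g)\ne 0$ for every $0\ne g\in S$. (Here $\mathbb N$ contains $0$, and $d=0$ is relevant only when $X$ is empty: otherwise the conditions with $d\ge 1$ are equivalent to those stated.) -/

import Mathlib

open Matrix

namespace KTheory

universe u v

/-! ### The group `K₀` of a unital `*`-algebra -/

section MvN

variable {A : Type u} [Ring A] [StarRing A]

/-- Murray–von Neumann equivalence of square matrices `p`, `q` of possibly different sizes: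
there is a rectangular matrix `v` with `v* v = p` and `v v* = q`. -/
def MvN {ι κ : Type} [Fintype ι] [Fintype κ] (p : Matrix ι ι A) (q : Matrix κ κ A) : Prop :=
  ∃ v : Matrix κ ι A, vᴴ * v = p ∧ v * vᴴ = q

/-- The orthogonal sum `diag(p, q)`. -/
def dsum {m n : ℕ} (p : Matrix (Fin m) (Fin m) A) (q : Matrix (Fin n) (Fin n) A) :
    Matrix (Fin (m + n)) (Fin (m + n)) A :=
  (Matrix.fromBlocks p 0 0 q).submatrix finSumFinEquiv.symm finSumFinEquiv.symm

theorem MvN.refl {ι : Type} [Fintype ι] {p : Matrix ι ι A} (hp : IsStarProjection p) :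
    MvN p p := by
  refine ⟨p, ?_, ?_⟩ <;>
  · rw [← Matrix.star_eq_conjTranspose, hp.isSelfAdjoint.star_eq, hp.isIdempotentElem.eq]

theorem MvN.symm {ι κ : Type} [Fintype ι] [Fintype κ] {p : Matrix ι ι A} {q : Matrix κ κ A}
    (h : MvN p q) : MvN q p := by
  obtain ⟨v, h1, h2⟩ := h
  exact ⟨vᴴ, by simpa using h2, by simpa using h1⟩

theorem MvN.trans {ι κ μ : Type} [Fintype ι] [Fintype κ] [Fintype μ] {p : Matrix ι ι A}
    {q : Matrix κ κ A} {r : Matrix μ μ A} (hp : IsIdempotentElem p) (hr : IsIdempotentElem r)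
    (h : MvN p q) (h' : MvN q r) : MvN p r := by
  obtain ⟨v, h1, h2⟩ := h
  obtain ⟨w, h3, h4⟩ := h'
  refine ⟨w * v, ?_, ?_⟩
  · calc (w * v)ᴴ * (w * v) = vᴴ * (wᴴ * w) * v := by
          simp only [Matrix.conjTranspose_mul, Matrix.mul_assoc]
      _ = (vᴴ * v) * (vᴴ * v) := by rw [h3, ← h2]; simp only [Matrix.mul_assoc]
      _ = p := by rw [h1]; exact hp
  · calc (w * v) * (w * v)ᴴ = w * (v * vᴴ) * wᴴ := by
          simp only [Matrix.conjTranspose_mul, Matrix.mul_assoc]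
      _ = (w * wᴴ) * (w * wᴴ) := by rw [h2, ← h3]; simp only [Matrix.mul_assoc]
      _ = r := by rw [h4]; exact hr

theorem MvN.submatrix {ι κ : Type} [Fintype ι] [Fintype κ] {p : Matrix ι ι A}
    (hp : IsStarProjection p) (e : κ ≃ ι) : MvN p (p.submatrix e e) := by
  have h : p * p = p := hp.isIdempotentElem
  have h' : pᴴ = p := hp.isSelfAdjoint
  refine ⟨p.submatrix e id, ?_, ?_⟩
  · rw [Matrix.conjTranspose_submatrix, h']
    have := Matrix.submatrix_mul_equiv p p (id : ι → ι) e (id : ι → ι)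
    rw [this, h, Matrix.submatrix_id_id]
  · rw [Matrix.conjTranspose_submatrix, h']
    have := Matrix.submatrix_mul_equiv p p e (Equiv.refl ι) e
    simp only [Equiv.coe_refl] at this
    rw [this, h]

theorem MvN.fromBlocks {ι κ ι' κ' : Type} [Fintype ι] [Fintype κ] [Fintype ι'] [Fintype κ']
    {p : Matrix ι ι A} {q : Matrix κ κ A} {p' : Matrix ι' ι' A} {q' : Matrix κ' κ' A}
    (h : MvN p p') (h' : MvN q q') :
    MvN (Matrix.fromBlocks p 0 0 q) (Matrix.fromBlocks p' 0 0 q') := by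
  obtain ⟨v, h1, h2⟩ := h
  obtain ⟨w, h3, h4⟩ := h'
  refine ⟨Matrix.fromBlocks v 0 0 w, ?_, ?_⟩ <;>
  simp [Matrix.fromBlocks_conjTranspose, Matrix.fromBlocks_multiply, h1, h2, h3, h4]

theorem isStarProjection_submatrix {ι κ : Type} [Fintype ι] [Fintype κ] {p : Matrix ι ι A}
    (hp : IsStarProjection p) (e : κ ≃ ι) : IsStarProjection (p.submatrix e e) := by
  have h : p * p = p := hp.isIdempotentElem
  have h' : pᴴ = p := hp.isSelfAdjoint
  refine ⟨?_, ?_⟩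
  · change p.submatrix e e * p.submatrix e e = p.submatrix e e
    rw [Matrix.submatrix_mul_equiv, h]
  · change (p.submatrix e e)ᴴ = p.submatrix e e
    rw [Matrix.conjTranspose_submatrix, h']

theorem isStarProjection_fromBlocks {ι κ : Type} [Fintype ι] [Fintype κ] {p : Matrix ι ι A}
    {q : Matrix κ κ A} (hp : IsStarProjection p) (hq : IsStarProjection q) :
    IsStarProjection (Matrix.fromBlocks p 0 0 q) := by
  have h1 : p * p = p := hp.isIdempotentElem
  have h2 : pᴴ = p := hp.isSelfAdjoint
  have h3 : q * q = q := hq.isIdempotentElem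
  have h4 : qᴴ = q := hq.isSelfAdjoint
  refine ⟨?_, ?_⟩
  · change Matrix.fromBlocks p 0 0 q * Matrix.fromBlocks p 0 0 q = Matrix.fromBlocks p 0 0 q
    simp [Matrix.fromBlocks_multiply, h1, h3]
  · change (Matrix.fromBlocks p 0 0 q)ᴴ = Matrix.fromBlocks p 0 0 q
    simp [Matrix.fromBlocks_conjTranspose, h2, h4]

theorem isStarProjection_dsum {m n : ℕ} {p : Matrix (Fin m) (Fin m) A}
    {q : Matrix (Fin n) (Fin n) A} (hp : IsStarProjection p) (hq : IsStarProjection q) :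
    IsStarProjection (dsum p q) :=
  isStarProjection_submatrix (isStarProjection_fromBlocks hp hq) _

theorem MvN.dsum_iff {m n : ℕ} {p : Matrix (Fin m) (Fin m) A}
    {q : Matrix (Fin n) (Fin n) A} (hp : IsStarProjection p) (hq : IsStarProjection q) :
    MvN (Matrix.fromBlocks p 0 0 q) (dsum p q) :=
  MvN.submatrix (isStarProjection_fromBlocks hp hq) _

end MvN

section K0

variable (A : Type u) [Ring A] [StarRing A]

/-- `P_∞(A)`: projections in matrix algebras `M_n(A)`, `n ∈ ℕ`. -/
abbrev Proj : Type u := Σ n : ℕ, {p : Matrix (Fin n) (Fin n) A // IsStarProjection p}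

/-- Murray–von Neumann equivalence on `P_∞(A)`. -/
instance projSetoid : Setoid (Proj A) where
  r p q := MvN p.2.1 q.2.1
  iseqv :=
    { refl := fun p => MvN.refl p.2.2
      symm := fun h => h.symm
      trans := fun {p _ r} h h' =>
        h.trans p.2.2.isIdempotentElem r.2.2.isIdempotentElem h' }

/-- The semigroup `V(A)` of Murray–von Neumann classes of projections in matrices over `A`,
with addition the orthogonal sum. -/
def V : Type u := Quotient (projSetoid A)

variable {A}

/-- The class of a projection in `V(A)`. -/
def V.mk {n : ℕ} (p : Matrix (Fin n) (Fin n) A) (hp : IsStarProjection p) : V A :=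
  Quotient.mk (projSetoid A) ⟨n, p, hp⟩

theorem V.mk_eq_mk {m n : ℕ} {p : Matrix (Fin m) (Fin m) A} {q : Matrix (Fin n) (Fin n) A}
    {hp : IsStarProjection p} {hq : IsStarProjection q} :
    V.mk p hp = V.mk q hq ↔ MvN p q :=
  Quotient.eq (r := projSetoid A)

theorem V.ind {P : V A → Prop}
    (h : ∀ (n : ℕ) (p : Matrix (Fin n) (Fin n) A) (hp : IsStarProjection p), P (V.mk p hp))
    (x : V A) : P x :=
  Quotient.inductionOn (s := projSetoid A) x fun a => h a.1 a.2.1 a.2.2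

/-- Addition in `V(A)`: `[p] + [q] = [diag(p, q)]`. -/
def V.add : V A → V A → V A :=
  Quotient.map₂ (fun p q => ⟨p.1 + q.1, dsum p.2.1 q.2.1, isStarProjection_dsum p.2.2 q.2.2⟩)
    (by
      intro p p' h q q' h'
      have e1 := (MvN.dsum_iff p.2.2 q.2.2).symm
      have e2 : MvN (Matrix.fromBlocks p.2.1 0 0 q.2.1) (Matrix.fromBlocks p'.2.1 0 0 q'.2.1) :=
        MvN.fromBlocks h h'
      have e3 := MvN.dsum_iff p'.2.2 q'.2.2
      have i1 := isStarProjection_dsum p.2.2 q.2.2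
      have i2 := isStarProjection_fromBlocks p'.2.2 q'.2.2
      have i3 := isStarProjection_dsum p'.2.2 q'.2.2
      exact (e1.trans i1.isIdempotentElem i2.isIdempotentElem e2).trans
        i1.isIdempotentElem i3.isIdempotentElem e3)

theorem V.add_mk {m n : ℕ} (p : Matrix (Fin m) (Fin m) A) (q : Matrix (Fin n) (Fin n) A)
    (hp : IsStarProjection p) (hq : IsStarProjection q) :
    V.add (V.mk p hp) (V.mk q hq) = V.mk (dsum p q) (isStarProjection_dsum hp hq) := rfl

theorem V.mk_submatrix {m n : ℕ} {p : Matrix (Fin m) (Fin m) A} {q : Matrix (Fin n) (Fin n) A}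
    (hp : IsStarProjection p) (hq : IsStarProjection q) (e : Fin n ≃ Fin m)
    (h : p.submatrix e e = q) : V.mk p hp = V.mk q hq := by
  subst h
  exact V.mk_eq_mk.2 (MvN.submatrix hp e)

theorem isStarProjection_zero' {n : ℕ} : IsStarProjection (0 : Matrix (Fin n) (Fin n) A) :=
  ⟨by simp [IsIdempotentElem], by simp [IsSelfAdjoint]⟩

theorem V.add_assoc' (x y z : V A) : V.add (V.add x y) z = V.add x (V.add y z) := by
  induction x using V.ind with | _ l p hp
  induction y using V.ind with | _ m q hq
  induction z using V.ind with | _ n r hr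
  simp only [V.add_mk]
  refine V.mk_submatrix _ _
    (finSumFinEquiv.symm.trans <| (Equiv.sumCongr (Equiv.refl _) finSumFinEquiv.symm).trans <|
      (Equiv.sumAssoc _ _ _).symm.trans <|
      (Equiv.sumCongr finSumFinEquiv (Equiv.refl _)).trans finSumFinEquiv) ?_
  ext i j
  obtain ⟨i, rfl⟩ := finSumFinEquiv.surjective i
  obtain ⟨j, rfl⟩ := finSumFinEquiv.surjective j
  rcases i with i | i <;> rcases j with j | j
  · simp [dsum, -finSumFinEquiv_apply_left, -finSumFinEquiv_apply_right]
  · obtain ⟨j, rfl⟩ := finSumFinEquiv.surjective j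
    rcases j with j | j <;>
    simp [dsum, -finSumFinEquiv_apply_left, -finSumFinEquiv_apply_right]
  · obtain ⟨i, rfl⟩ := finSumFinEquiv.surjective i
    rcases i with i | i <;>
    simp [dsum, -finSumFinEquiv_apply_left, -finSumFinEquiv_apply_right]
  · obtain ⟨i, rfl⟩ := finSumFinEquiv.surjective i
    obtain ⟨j, rfl⟩ := finSumFinEquiv.surjective j
    rcases i with i | i <;> rcases j with j | j <;>
    simp [dsum, -finSumFinEquiv_apply_left, -finSumFinEquiv_apply_right]

theorem V.add_comm' (x y : V A) : V.add x y = V.add y x := by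
  induction x using V.ind with | _ m p hp
  induction y using V.ind with | _ n q hq
  simp only [V.add_mk]
  refine V.mk_submatrix _ _
    ((finSumFinEquiv.symm.trans (Equiv.sumComm _ _)).trans finSumFinEquiv) ?_
  ext i j
  obtain ⟨i, rfl⟩ := finSumFinEquiv.surjective i
  obtain ⟨j, rfl⟩ := finSumFinEquiv.surjective j
  rcases i with i | i <;> rcases j with j | j <;>
  simp [dsum, -finSumFinEquiv_apply_left, -finSumFinEquiv_apply_right]

/-- The zero of `V(A)`, the class of the zero projection. -/
def V.zero : V A := V.mk (0 : Matrix (Fin 0) (Fin 0) A) isStarProjection_zero'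

theorem V.add_zero' (x : V A) : V.add x V.zero = x := by
  induction x using V.ind with | _ n p hp
  simp only [V.add_mk, V.zero]
  refine V.mk_submatrix _ _ ((Equiv.sumEmpty _ _).symm.trans finSumFinEquiv) ?_
  ext i j
  simp [dsum, -finSumFinEquiv_apply_left, -finSumFinEquiv_apply_right]

instance : AddCommMonoid (V A) where
  add := V.add
  zero := V.zero
  add_assoc := V.add_assoc'
  zero_add x := (V.add_comm' _ x).trans (V.add_zero' x)
  add_zero := V.add_zero'
  add_comm := V.add_comm'
  nsmul := @nsmulRec _ ⟨V.zero⟩ ⟨V.add⟩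

variable (A) in
/-- `K₀(A)` of a unital `*`-algebra `A`: the Grothendieck group of `V(A)`. -/
abbrev K0 : Type u := Algebra.GrothendieckAddGroup (V A)

/-- The class `[p]` in `K₀(A)` of a projection in a matrix algebra over `A`. -/
noncomputable def K0.cls {n : ℕ} (p : Matrix (Fin n) (Fin n) A) (hp : IsStarProjection p) :
    K0 A :=
  Algebra.GrothendieckAddGroup.of (V.mk p hp)

variable (A) in
/-- The positive cone `K₀(A)⁺`: the classes of projections in matrix algebras over `A`. -/
def K0.pos : Set (K0 A) := {g | ∃ (n : ℕ) (p : Matrix (Fin n) (Fin n) A)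
  (hp : IsStarProjection p), g = K0.cls p hp}

theorem isStarProjection_one' : IsStarProjection (1 : Matrix (Fin 1) (Fin 1) A) :=
  ⟨by simp [IsIdempotentElem], by simp [IsSelfAdjoint]⟩

variable (A) in
/-- The order unit `[1]` of `K₀(A)`. -/
noncomputable def K0.unit : K0 A := K0.cls (1 : Matrix (Fin 1) (Fin 1) A) isStarProjection_one'

theorem K0.hom_ext {G : Type v} [AddCommGroup G] {f g : K0 A →+ G}
    (h : ∀ (n : ℕ) (p : Matrix (Fin n) (Fin n) A) (hp : IsStarProjection p),
      f (K0.cls p hp) = g (K0.cls p hp)) : f = g := by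
  apply Algebra.GrothendieckAddGroup.lift.symm.injective
  ext x
  induction x using V.ind with | _ n p hp
  exact h n p hp

end K0

section Functoriality

variable {A B C : Type u} [Ring A] [StarRing A] [Algebra ℂ A] [Ring B] [StarRing B] [Algebra ℂ B]
  [Ring C] [StarRing C] [Algebra ℂ C]

theorem isStarProjection_map (φ : A →⋆ₐ[ℂ] B) {n : ℕ} {p : Matrix (Fin n) (Fin n) A}
    (hp : IsStarProjection p) : IsStarProjection (p.map φ) := by
  have h : p * p = p := hp.isIdempotentElem
  have h' : pᴴ = p := hp.isSelfAdjoint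
  refine ⟨?_, ?_⟩
  · change p.map φ * p.map φ = p.map φ
    rw [← Matrix.map_mul, h]
  · change (p.map φ)ᴴ = p.map φ
    rw [← Matrix.conjTranspose_map φ (fun a => map_star φ a), h']

theorem MvN.map (φ : A →⋆ₐ[ℂ] B) {ι κ : Type} [Fintype ι] [Fintype κ] {p : Matrix ι ι A}
    {q : Matrix κ κ A} (h : MvN p q) : MvN (p.map φ) (q.map φ) := by
  obtain ⟨v, h1, h2⟩ := h
  refine ⟨v.map φ, ?_, ?_⟩
  · rw [← Matrix.conjTranspose_map φ (fun a => map_star φ a), ← Matrix.map_mul, h1]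
  · rw [← Matrix.conjTranspose_map φ (fun a => map_star φ a), ← Matrix.map_mul, h2]

/-- The map `V(A) → V(B)`, `[p] ↦ [φ(p)]`, induced by a `*`-homomorphism `φ : A → B`. -/
def V.map (φ : A →⋆ₐ[ℂ] B) : V A →+ V B where
  toFun := Quotient.map (fun p => ⟨p.1, p.2.1.map φ, isStarProjection_map φ p.2.2⟩)
    (fun _ _ h => MvN.map φ h)
  map_zero' := by
    change V.mk _ _ = V.mk _ _
    exact V.mk_eq_mk.2 ⟨0, Subsingleton.elim _ _, Subsingleton.elim _ _⟩
  map_add' x y := by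
    induction x using V.ind with | _ m p hp
    induction y using V.ind with | _ n q hq
    change V.mk _ _ = V.mk _ _
    congr 1
    ext i j
    obtain ⟨i, rfl⟩ := finSumFinEquiv.surjective i
    obtain ⟨j, rfl⟩ := finSumFinEquiv.surjective j
    rcases i with i | i <;> rcases j with j | j <;>
    simp [dsum, -finSumFinEquiv_apply_left, -finSumFinEquiv_apply_right]

theorem V.map_mk (φ : A →⋆ₐ[ℂ] B) {n : ℕ} (p : Matrix (Fin n) (Fin n) A)
    (hp : IsStarProjection p) :
    V.map φ (V.mk p hp) = V.mk (p.map φ) (isStarProjection_map φ hp) := rfl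

/-- The group homomorphism `K₀(φ) : K₀(A) → K₀(B)` induced by a `*`-homomorphism `φ : A → B`. -/
noncomputable def K0.map (φ : A →⋆ₐ[ℂ] B) : K0 A →+ K0 B :=
  Algebra.GrothendieckAddGroup.lift (Algebra.GrothendieckAddGroup.of.comp (V.map φ))

theorem K0.map_cls (φ : A →⋆ₐ[ℂ] B) {n : ℕ} (p : Matrix (Fin n) (Fin n) A)
    (hp : IsStarProjection p) :
    K0.map φ (K0.cls p hp) = K0.cls (p.map φ) (isStarProjection_map φ hp) := by
  have := Algebra.GrothendieckAddGroup.lift.symm_apply_apply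
    ((Algebra.GrothendieckAddGroup.of (M := V B)).comp (V.map φ))
  exact DFunLike.congr_fun this (V.mk p hp)

theorem K0.map_id : K0.map (StarAlgHom.id ℂ A) = AddMonoidHom.id (K0 A) := by
  apply K0.hom_ext
  intro n p hp
  rw [K0.map_cls]
  rfl

theorem K0.map_comp (ψ : B →⋆ₐ[ℂ] C) (φ : A →⋆ₐ[ℂ] B) :
    K0.map (ψ.comp φ) = (K0.map ψ).comp (K0.map φ) := by
  apply K0.hom_ext
  intro n p hp
  simp only [AddMonoidHom.comp_apply, K0.map_cls]
  rfl

theorem K0.map_unit (φ : A →⋆ₐ[ℂ] B) : K0.map φ (K0.unit A) = K0.unit B := by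
  simp only [K0.unit, K0.map_cls]
  congr 1
  simp

theorem K0.map_mem_pos (φ : A →⋆ₐ[ℂ] B) {g : K0 A} (hg : g ∈ K0.pos A) :
    K0.map φ g ∈ K0.pos B := by
  obtain ⟨n, p, hp, rfl⟩ := hg
  exact ⟨n, _, _, K0.map_cls φ p hp⟩

end Functoriality

/-! ### Ordered abelian groups with order unit, and actions on them -/

/-- `OAut(G, G⁺, u)`: the group automorphisms `τ` of `G` with `τ(G⁺) = G⁺` and `τ(u) = u`,
for a cone `G⁺ = P` and an order unit `u = e`. -/
def OAut (G : Type u) [AddCommGroup G] (P : Set G) (e : G) : Type u :=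
  {τ : G ≃+ G // τ '' P = P ∧ τ e = e}

namespace OAut

variable {G : Type u} [AddCommGroup G] {P : Set G} {e : G}

instance : CoeFun (OAut G P e) (fun _ => G → G) := ⟨fun τ => τ.1⟩

/-- `OAut` is a group under composition. -/
instance : Group (OAut G P e) where
  mul a b := ⟨b.1.trans a.1, by
    obtain ⟨a, ha, ha'⟩ := a
    obtain ⟨b, hb, hb'⟩ := b
    refine ⟨?_, ?_⟩
    · change (fun g => a (b g)) '' P = P
      rw [← Set.image_image (fun g => a g) (fun g => b g), hb, ha]
    · simp [ha', hb']⟩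
  one := ⟨AddEquiv.refl G, by simp⟩
  inv a := ⟨a.1.symm, by
    obtain ⟨a, ha, ha'⟩ := a
    refine ⟨?_, ?_⟩
    · change a.symm '' P = P
      conv_lhs => rw [← ha]
      rw [Set.image_image]
      simp
    · exact a.symm_apply_eq.2 ha'.symm⟩
  mul_assoc _ _ _ := rfl
  one_mul _ := rfl
  mul_one _ := rfl
  inv_mul_cancel a := Subtype.ext (AddEquiv.self_trans_symm a.1)

theorem mul_apply (a b : OAut G P e) (g : G) : (a * b) g = a (b g) := rfl

theorem one_apply (g : G) : (1 : OAut G P e) g = g := rfl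

end OAut

/-- The automorphism group of `ℤᵈ` with the cone `(ℤ_{≥0})ᵈ` and the order unit `(1, …, 1)`. -/
abbrev OAutZ (d : ℕ) : Type := OAut (Fin d → ℤ) {x | ∀ i, 0 ≤ x i} (fun _ => 1)

/-- The automorphism `K₀(φ)` of the group `K₀(A)` induced by an automorphism `φ` of `A`. -/
noncomputable def K0.aut {A : Type u} [Ring A] [StarRing A] [Algebra ℂ A] (φ : A ≃⋆ₐ[ℂ] A) :
    K0 A ≃+ K0 A :=
  AddMonoidHom.toAddEquiv (K0.map (φ : A →⋆ₐ[ℂ] A)) (K0.map (φ.symm : A →⋆ₐ[ℂ] A))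
    (by
      rw [← K0.map_comp, ← K0.map_id]
      congr 1
      ext a
      simp)
    (by
      rw [← K0.map_comp, ← K0.map_id]
      congr 1
      ext a
      simp)

theorem K0.aut_apply {A : Type u} [Ring A] [StarRing A] [Algebra ℂ A] (φ : A ≃⋆ₐ[ℂ] A)
    (g : K0 A) : K0.aut φ g = K0.map (φ : A →⋆ₐ[ℂ] A) g := rfl

theorem K0.aut_mul_apply {A : Type u} [Ring A] [StarRing A] [Algebra ℂ A] (φ ψ : A ≃⋆ₐ[ℂ] A)
    (g : K0 A) : K0.aut (φ * ψ) g = K0.aut φ (K0.aut ψ g) := by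
  change K0.map _ g = ((K0.map _).comp (K0.map _)) g
  rw [← K0.map_comp]
  rfl

theorem K0.aut_mem {A : Type u} [Ring A] [StarRing A] [Algebra ℂ A] (φ : A ≃⋆ₐ[ℂ] A) :
    K0.aut φ '' K0.pos A = K0.pos A ∧ K0.aut φ (K0.unit A) = K0.unit A := by
  refine ⟨Set.Subset.antisymm ?_ ?_, K0.map_unit _⟩
  · rintro _ ⟨g, hg, rfl⟩
    exact K0.map_mem_pos _ hg
  · intro g hg
    exact ⟨K0.map (φ.symm : A →⋆ₐ[ℂ] A) g, K0.map_mem_pos _ hg, (K0.aut φ).apply_symm_apply g⟩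

/-- The action `α̂ : Γ → OAut(K₀(A))`, `α̂ₛ = K₀(αₛ)`, induced by an action `α : Γ → Aut(A)`. -/
noncomputable def K0.hat {A : Type u} [Ring A] [StarRing A] [Algebra ℂ A] {Γ : Type v} [Group Γ]
    (α : Γ →* (A ≃⋆ₐ[ℂ] A)) : Γ →* OAut (K0 A) (K0.pos A) (K0.unit A) :=
  MonoidHom.mk' (fun s => ⟨K0.aut (α s), K0.aut_mem (α s)⟩)
    (fun s t => Subtype.ext (AddEquiv.ext fun g => by
      change K0.aut (α (s * t)) g = K0.aut (α s) (K0.aut (α t) g)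
      rw [map_mul, K0.aut_mul_apply]))

theorem K0.hat_apply {A : Type u} [Ring A] [StarRing A] [Algebra ℂ A] {Γ : Type v} [Group Γ]
    (α : Γ →* (A ≃⋆ₐ[ℂ] A)) (s : Γ) (g : K0 A) :
    K0.hat α s g = K0.map (α s : A →⋆ₐ[ℂ] A) g := rfl

/-- `S_F = {α̂ₜ(x) : x ∈ S, t ∈ F ∪ {e}}`. -/
def iterates {G : Type u} [AddCommGroup G] {P : Set G} {e : G} {Γ : Type v} [Group Γ]
    (a : Γ →* OAut G P e) (S : Finset G) (F : Finset Γ) : Set G :=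
  {y | ∃ x ∈ S, ∃ t : Γ, (t ∈ F ∨ t = 1) ∧ y = a t x}

end KTheory

namespace TopDyn

/-- The action `α` on `C(X)` induced by a continuous action `h` on `X`: `αₛ(f)(x) = f(s⁻¹ x)`. -/
noncomputable def inducedAction {Γ : Type*} [Group Γ] {X : Type*} [TopologicalSpace X] (h : Γ →* (X ≃ₜ X)) :
    Γ →* (C(X, ℂ) ≃⋆ₐ[ℂ] C(X, ℂ)) :=
  MonoidHom.mk' (fun s => Homeomorph.compStarAlgEquiv' ℂ ℂ (h s⁻¹))
    (fun s t => by
      ext f x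
      simp)

theorem inducedAction_apply {Γ : Type*} [Group Γ] {X : Type*} [TopologicalSpace X]
    (h : Γ →* (X ≃ₜ X)) (s : Γ) (f : C(X, ℂ)) (x : X) :
    inducedAction h s f x = f (h s⁻¹ x) := rfl

/-- Residual finiteness of a continuous action `h` of `Γ` on a metric space `X`: for all `ε > 0`
and finite `F ⊆ Γ` there are an action `k` of `Γ` on a finite set `E` and a map `ζ : E → X` with
`ε`-dense range which is `ε`-equivariant for the elements of `F`. -/
def IsResiduallyFinite {Γ : Type*} [Group Γ] {X : Type*} [MetricSpace X]
    (h : Γ →* (X ≃ₜ X)) : Prop :=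
  ∀ ε : ℝ, 0 < ε → ∀ F : Finset Γ,
    ∃ (E : Type) (_ : Finite E) (k : Γ →* Equiv.Perm E) (ζ : E → X),
      (∀ s ∈ F, ∀ z : E, dist (ζ (k s z)) (h s (ζ z)) < ε) ∧
      (∀ x : X, ∃ z : E, dist x (ζ z) < ε)

end TopDyn

/-!
The traces of projections over the commutative algebra `C(X)` induce, for each point `x ∈ X`, a
positive unital homomorphism `K0.rankAt x : K₀(C(X)) → ℤ`, `[p] ↦ rank p(x)`. For a fixed `g` this
is a locally constant function of `x`, and a positive `g` vanishes as soon as all its ranks do.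

If the action is residually finite, a sufficiently good finite model `ζ : E → X` therefore yields
`β = (rankAt (ζ z))_z : K₀(C(X)) → ℤ^E`: approximate equivariance of `ζ` becomes exact equivariance
of `β` on a finite set of classes, and density of the range of `ζ` makes `β` nonzero on them
(`TopDyn.IsResiduallyFinite.exists_hom`). Restricting such a `β` is trivial.

Conversely (`TopDyn.isResiduallyFinite_of_exists_hom`), take a partition of `X` into nonempty clopen
sets `W j` which are small together with their translates by `F`, and a `β` for the classes
`[1_{W j}]`. Their images are nonnegative and sum to `(1, …, 1)`, so every coordinate `i` is charged
by some `W (c i)`; let `ζ i` be a point of that set. Automorphisms of the ordered group `ℤᵈ`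
are permutations of the coordinates (`OAutZ.toPerm`), so `Γ` acts on `Fin d`. Positivity forces two
clopen sets charging the same coordinate to intersect (`exists_mem_inter_of_one_le`), since otherwise
the complement of their union would have a negative image. Applied to `h s (W (c i))` and
`W (c (s • i))` this shows that `ζ` is approximately equivariant; applied to `W j` and any `W (c i)`
with `i` charged by `W j`, it shows that the range of `ζ` is dense up to `ε`. Only the additivity of
classes of orthogonal projections (`K0.cls_add`) enters, not the identification of `K₀(C(X))` with
`C(X, ℤ)`.
-/

namespace KTheory

universe u

/-! ### The trace on `K₀` of a commutative `*`-algebra -/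

section Trace

variable {A : Type u} [CommRing A] [StarRing A]

/-- The trace of projections as a map `V(A) → A`, for a commutative `*`-algebra `A`. -/
def V.trace : V A →+ A where
  toFun := Quotient.lift (fun p : Proj A => p.2.1.trace) fun p q hpq => by
    obtain ⟨v, h1, h2⟩ : MvN p.2.1 q.2.1 := hpq
    rw [← h1, ← h2, Matrix.trace_mul_comm]
  map_zero' := Matrix.trace_zero _ _
  map_add' x y := by
    induction x using V.ind with | _ m p hp
    induction y using V.ind with | _ n q hq
    change (dsum p q).trace = p.trace + q.trace
    simp only [dsum, Matrix.trace, Matrix.diag_apply, Matrix.submatrix_apply]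
    rw [← Equiv.sum_comp finSumFinEquiv]
    simp [-finSumFinEquiv_apply_left, -finSumFinEquiv_apply_right]

/-- The trace homomorphism `K₀(A) → A`, `[p] ↦ tr p`, for a commutative `*`-algebra `A`. -/
noncomputable def K0.trace : K0 A →+ A :=
  Algebra.GrothendieckAddGroup.lift V.trace

theorem K0.trace_cls {n : ℕ} (p : Matrix (Fin n) (Fin n) A) (hp : IsStarProjection p) :
    K0.trace (K0.cls p hp) = p.trace :=
  DFunLike.congr_fun (Algebra.GrothendieckAddGroup.lift.symm_apply_apply (V.trace (A := A)))
    (V.mk p hp)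

end Trace

/-! ### Classes of projections in `K₀` -/

section Classes

variable {A : Type u} [Ring A] [StarRing A]

/-- Every element of `K₀(A)` is a difference of two positive elements. -/
theorem K0.exists_eq_sub (g : K0 A) : ∃ a ∈ K0.pos A, ∃ b ∈ K0.pos A, g = a - b := by
  induction g using AddLocalization.induction_on with | _ y
  obtain ⟨x, y, hy⟩ := y
  refine ⟨Algebra.GrothendieckAddGroup.of x, ?_, Algebra.GrothendieckAddGroup.of y, ?_, ?_⟩
  · induction x using V.ind with | _ n p hp
    exact ⟨n, p, hp, rfl⟩
  · induction y using V.ind with | _ n p hp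
    exact ⟨n, p, hp, rfl⟩
  · change _ = AddLocalization.mk x 0 - AddLocalization.mk y 0
    rw [Algebra.GrothendieckAddGroup.mk_sub_mk]
    simp

theorem K0.cls_zero {n : ℕ} (h : IsStarProjection (0 : Matrix (Fin n) (Fin n) A)) :
    K0.cls 0 h = 0 := by
  have : V.mk 0 h = (0 : V A) := V.mk_eq_mk.2 ⟨0, by simp, by simp⟩
  rw [K0.cls, this, map_zero]

/-- Orthogonal projections of the same size add up: `[p + q] = [p] + [q]`. The partial isometry
implementing the equivalence of `p + q` with `diag(p, q)` is the column with entries `p`, `q`. -/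
theorem K0.cls_add {n : ℕ} {p q : Matrix (Fin n) (Fin n) A} (hp : IsStarProjection p)
    (hq : IsStarProjection q) (hpq : p * q = 0) (h : IsStarProjection (p + q)) :
    K0.cls (p + q) h = K0.cls p hp + K0.cls q hq := by
  have hp1 : p * p = p := hp.isIdempotentElem
  have hq1 : q * q = q := hq.isIdempotentElem
  have hp2 : pᴴ = p := hp.isSelfAdjoint
  have hq2 : qᴴ = q := hq.isSelfAdjoint
  have hqp : q * p = 0 := by
    simpa [hp2, hq2] using congrArg Matrix.conjTranspose hpq
  have key : MvN (p + q) (Matrix.fromBlocks p 0 0 q) := by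
    refine ⟨Matrix.fromRows p q, ?_, ?_⟩
    · rw [Matrix.conjTranspose_fromRows_eq_fromCols_conjTranspose, Matrix.fromCols_mul_fromRows,
        hp2, hq2, hp1, hq1]
    · rw [Matrix.conjTranspose_fromRows_eq_fromCols_conjTranspose, Matrix.fromRows_mul_fromCols,
        hp2, hq2, hp1, hq1, hpq, hqp]
  have e : V.mk (p + q) h = V.mk p hp + V.mk q hq :=
    V.mk_eq_mk.2 (key.trans h.isIdempotentElem (isStarProjection_dsum hp hq).isIdempotentElem
      (MvN.dsum_iff hp hq))
  rw [K0.cls, e, map_add]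
  rfl

end Classes

/-! ### Ranks at points of `X` -/

section RankAt

variable {X : Type u} [TopologicalSpace X]

theorem exists_nat_trace_eq {n : ℕ} {p : Matrix (Fin n) (Fin n) ℂ} (hp : IsIdempotentElem p) :
    ∃ k : ℕ, p.trace = k := by
  have h : IsIdempotentElem (Matrix.toLin' p) := by
    rw [IsIdempotentElem, Module.End.mul_eq_comp, ← Matrix.toLin'_mul, hp.eq]
  exact ⟨_, by rw [← Matrix.trace_toLin'_eq,
    (LinearMap.IsIdempotentElem.isProj_range _ h).trace]⟩

theorem isStarProjection_eval {n : ℕ} {p : Matrix (Fin n) (Fin n) C(X, ℂ)}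
    (hp : IsStarProjection p) (x : X) : IsStarProjection (p.map fun f => f x) :=
  ⟨by
    ext i j
    have := congrArg (fun q => q i j x) hp.isIdempotentElem.eq
    simpa [Matrix.mul_apply] using this,
  by
    ext i j
    exact congrArg (fun q => q i j x) hp.isSelfAdjoint.star_eq⟩

theorem K0.trace_cls_apply {n : ℕ} {p : Matrix (Fin n) (Fin n) C(X, ℂ)}
    (hp : IsStarProjection p) (x : X) :
    K0.trace (K0.cls p hp) x = (p.map fun f => f x).trace := by
  rw [K0.trace_cls]
  simp [Matrix.trace]

theorem K0.exists_nat_trace_apply {g : K0 C(X, ℂ)} (hg : g ∈ K0.pos C(X, ℂ)) (x : X) :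
    ∃ k : ℕ, K0.trace g x = k := by
  obtain ⟨n, p, hp, rfl⟩ := hg
  rw [K0.trace_cls_apply]
  exact exists_nat_trace_eq (isStarProjection_eval hp x).isIdempotentElem

theorem K0.exists_int_trace_apply (g : K0 C(X, ℂ)) (x : X) : ∃ k : ℤ, K0.trace g x = k := by
  obtain ⟨a, ha, b, hb, rfl⟩ := K0.exists_eq_sub g
  obtain ⟨k, hk⟩ := K0.exists_nat_trace_apply ha x
  obtain ⟨l, hl⟩ := K0.exists_nat_trace_apply hb x
  exact ⟨k - l, by simp [hk, hl]⟩

/-- The homomorphism `K₀(C(X)) → ℤ`, `[p] ↦ rank p(x)`, given by evaluation at `x ∈ X`; it is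
encoded as the value of the trace at `x`, which is an integer. -/
noncomputable def K0.rankAt (x : X) : K0 C(X, ℂ) →+ ℤ where
  toFun g := (K0.exists_int_trace_apply g x).choose
  map_zero' := Int.cast_injective (α := ℂ) <| by
    rw [← (K0.exists_int_trace_apply (0 : K0 C(X, ℂ)) x).choose_spec, map_zero, Int.cast_zero]
    rfl
  map_add' a b := Int.cast_injective (α := ℂ) <| by
    rw [Int.cast_add, ← (K0.exists_int_trace_apply (a + b) x).choose_spec,
      ← (K0.exists_int_trace_apply a x).choose_spec, ← (K0.exists_int_trace_apply b x).choose_spec,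
      map_add, ContinuousMap.add_apply]

theorem K0.rankAt_spec (g : K0 C(X, ℂ)) (x : X) : (K0.rankAt x g : ℂ) = K0.trace g x :=
  (K0.exists_int_trace_apply g x).choose_spec.symm

theorem K0.rankAt_nonneg {g : K0 C(X, ℂ)} (hg : g ∈ K0.pos C(X, ℂ)) (x : X) :
    0 ≤ K0.rankAt x g := by
  obtain ⟨k, hk⟩ := K0.exists_nat_trace_apply hg x
  have : K0.rankAt x g = k := by
    have h := K0.rankAt_spec g x
    rw [hk] at h
    exact_mod_cast h
  omega

theorem K0.rankAt_unit (x : X) : K0.rankAt x (K0.unit C(X, ℂ)) = 1 := by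
  have h := K0.rankAt_spec (K0.unit C(X, ℂ)) x
  rw [K0.unit, K0.trace_cls] at h
  simp only [Matrix.trace_one, Fintype.card_fin, Nat.cast_one, ContinuousMap.one_apply] at h
  exact_mod_cast h

/-- A positive element of rank zero at every point vanishes: a projection `p` satisfies
`tr (p* p) = tr p`, so it is zero wherever its trace is. -/
theorem K0.eq_zero_of_rankAt_eq_zero {g : K0 C(X, ℂ)} (hg : g ∈ K0.pos C(X, ℂ))
    (h : ∀ x, K0.rankAt x g = 0) : g = 0 := by
  obtain ⟨n, p, hp, rfl⟩ := hg
  have hp0 : p = 0 := by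
    ext i j x
    have hx := isStarProjection_eval hp x
    have h1 := K0.rankAt_spec (K0.cls p hp) x
    rw [h, K0.trace_cls_apply] at h1
    have h2 : (p.map fun f => f x)ᴴ * (p.map fun f => f x) = p.map fun f => f x := by
      rw [← Matrix.star_eq_conjTranspose, hx.isSelfAdjoint.star_eq, hx.isIdempotentElem.eq]
    open scoped ComplexOrder in
    have h3 : (p.map fun f => f x) = 0 := by
      rw [← Matrix.trace_conjTranspose_mul_self_eq_zero_iff, h2, ← h1, Int.cast_zero]
    exact congrFun (congrFun h3 i) j
  subst hp0
  exact K0.cls_zero hp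

theorem K0.rankAt_hat {Γ : Type*} [Group Γ] (h : Γ →* (X ≃ₜ X)) (t : Γ) (g : K0 C(X, ℂ)) (x : X) :
    K0.rankAt x (K0.hat (TopDyn.inducedAction h) t g) = K0.rankAt (h t⁻¹ x) g := by
  have : (K0.rankAt x).comp (K0.map (TopDyn.inducedAction h t : C(X, ℂ) →⋆ₐ[ℂ] C(X, ℂ))) =
      K0.rankAt (h t⁻¹ x) := by
    apply K0.hom_ext
    intro n p hp
    rw [← Int.cast_inj (α := ℂ), AddMonoidHom.comp_apply, K0.map_cls, K0.rankAt_spec,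
      K0.rankAt_spec, K0.trace_cls_apply, K0.trace_cls_apply, Matrix.map_map]
    rfl
  rw [K0.hat_apply, ← this]
  rfl

end RankAt

/-- On a compact metric space the ranks of finitely many elements of `K₀` do not change under
sufficiently small displacements. -/
theorem K0.exists_rankAt_eq_of_dist_lt {X : Type u} [MetricSpace X] [CompactSpace X]
    (S : Finset (K0 C(X, ℂ))) :
    ∃ ε > 0, ∀ g ∈ S, ∀ x y : X, dist x y < ε → K0.rankAt x g = K0.rankAt y g := by
  classical
  induction S using Finset.induction_on with
  | empty => exact ⟨1, one_pos, by simp⟩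
  | insert g S _ ih =>
    obtain ⟨ε, hε, ih⟩ := ih
    obtain ⟨δ, hδ, H⟩ := Metric.uniformContinuous_iff.1
      (CompactSpace.uniformContinuous_of_continuous (K0.trace g).continuous) 1 one_pos
    refine ⟨min ε δ, lt_min hε hδ, fun g' hg' x y hxy => ?_⟩
    rcases Finset.mem_insert.1 hg' with rfl | hg'
    · have := H (lt_of_lt_of_le hxy (min_le_right _ _))
      rw [← K0.rankAt_spec, ← K0.rankAt_spec, Complex.dist_eq, ← Int.cast_sub,
        Complex.norm_intCast] at this
      have h2 : |K0.rankAt x g' - K0.rankAt y g'| < 1 := by exact_mod_cast this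
      rw [Int.abs_lt_one_iff] at h2
      omega
    · exact ih g' hg' x y (lt_of_lt_of_le hxy (min_le_left _ _))

/-! ### Classes of clopen sets -/

section Clopen

open TopologicalSpace

variable {X : Type u} [TopologicalSpace X]

/-- The projection `1_U ∈ M₁(C(X))` of a clopen set `U`. -/
noncomputable def clopenProj (U : Clopens X) : Matrix (Fin 1) (Fin 1) C(X, ℂ) :=
  Matrix.of fun _ _ => (LocallyConstant.charFn ℂ U.isClopen : C(X, ℂ))

open Classical in
theorem clopenProj_apply (U : Clopens X) (i j : Fin 1) (x : X) :
    clopenProj U i j x = if x ∈ U then 1 else 0 := by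
  simp [clopenProj, LocallyConstant.coe_charFn, Set.indicator_apply]

theorem isStarProjection_clopenProj (U : Clopens X) : IsStarProjection (clopenProj U) := by
  classical
  refine ⟨?_, ?_⟩
  · change clopenProj U * clopenProj U = clopenProj U
    ext i j x
    simp [Matrix.mul_apply, clopenProj_apply]
  · change (clopenProj U)ᴴ = clopenProj U
    ext i j x
    simp [clopenProj_apply, apply_ite]

/-- The class `[1_U] ∈ K₀(C(X))` of a clopen set `U`. -/
noncomputable def clopenClass (U : Clopens X) : K0 C(X, ℂ) :=
  K0.cls (clopenProj U) (isStarProjection_clopenProj U)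

theorem clopenClass_mem_pos (U : Clopens X) : clopenClass U ∈ K0.pos C(X, ℂ) :=
  ⟨1, _, _, rfl⟩

theorem clopenClass_top : clopenClass (⊤ : Clopens X) = K0.unit C(X, ℂ) := by
  have : clopenProj (⊤ : Clopens X) = 1 := by
    ext i j x
    simp [clopenProj_apply, Matrix.one_apply, Subsingleton.elim i j, show x ∈ (⊤ : Clopens X) from trivial]
  simp only [clopenClass, K0.unit, this]

theorem clopenClass_bot : clopenClass (⊥ : Clopens X) = 0 := by
  have : clopenProj (⊥ : Clopens X) = 0 := by
    ext i j x
    simp [clopenProj_apply, show x ∉ (⊥ : Clopens X) from id]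
  simp only [clopenClass, this]
  exact K0.cls_zero _

theorem clopenClass_sup {U W : Clopens X} (hUW : Disjoint U W) :
    clopenClass (U ⊔ W) = clopenClass U + clopenClass W := by
  classical
  have hd : ∀ x, x ∈ U → x ∉ W := fun x hx hx' => by
    have : x ∈ U ⊓ W := ⟨hx, hx'⟩
    rw [hUW.eq_bot] at this
    exact this
  have e : clopenProj (U ⊔ W) = clopenProj U + clopenProj W := by
    ext i j x
    have : x ∈ U ⊔ W ↔ x ∈ U ∨ x ∈ W := Iff.rfl
    by_cases hU : x ∈ U <;> by_cases hW : x ∈ W <;>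
      simp_all [clopenProj_apply]
  have h0 : clopenProj U * clopenProj W = 0 := by
    ext i j x
    by_cases hU : x ∈ U <;> simp [Matrix.mul_apply, clopenProj_apply, hU, hd]
  simp only [clopenClass, e]
  exact K0.cls_add _ _ h0 _

theorem sum_clopenClass {ι : Type*} (s : Finset ι) (W : ι → Clopens X)
    (hW : Pairwise (Function.onFun Disjoint W)) :
    ∑ j ∈ s, clopenClass (W j) = clopenClass (s.sup W) := by
  classical
  induction s using Finset.induction_on with
  | empty => simp [clopenClass_bot]
  | insert a s ha ih =>
    rw [Finset.sum_insert ha, Finset.sup_insert, ih, clopenClass_sup]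
    refine Finset.disjoint_sup_right.2 fun j hj => hW ?_
    rintro rfl
    exact ha hj

theorem clopenClass_ne_zero {U : Clopens X} (hU : U ≠ ⊥) : clopenClass U ≠ 0 := by
  intro h0
  apply hU
  rw [eq_bot_iff]
  intro x hx
  have := congrArg (fun g : K0 C(X, ℂ) => K0.trace g x) h0
  simp only [clopenClass, K0.trace_cls_apply, map_zero, ContinuousMap.zero_apply] at this
  simp [Matrix.trace, clopenProj_apply, hx] at this

theorem hat_clopenClass {Γ : Type*} [Group Γ] (h : Γ →* (X ≃ₜ X)) (t : Γ) (U : Clopens X) :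
    K0.hat (TopDyn.inducedAction h) t (clopenClass U) =
      clopenClass ⟨h t⁻¹ ⁻¹' U, U.isClopen.preimage (h t⁻¹).continuous⟩ := by
  rw [K0.hat_apply]
  simp only [clopenClass, K0.map_cls]
  congr 1

/-- Clopen sets whose classes are both nonzero at the same coordinate of a positive unital map into
`ℤᵈ` intersect. Otherwise the complement of their union has class `[1] - [1_U] - [1_W]`, which
would have a negative value at that coordinate. -/
theorem exists_mem_inter_of_one_le {d : ℕ} {H : AddSubgroup (K0 C(X, ℂ))} {β : H →+ (Fin d → ℤ)}
    (h1 : K0.unit C(X, ℂ) ∈ H)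
    (hβ : ∀ g : H, (g : K0 C(X, ℂ)) ∈ K0.pos C(X, ℂ) → ∀ i, 0 ≤ β g i)
    (hβ1 : β ⟨K0.unit C(X, ℂ), h1⟩ = fun _ => 1) {U W : Clopens X} (hU : clopenClass U ∈ H)
    (hW : clopenClass W ∈ H) {i : Fin d} (hUi : 1 ≤ β ⟨_, hU⟩ i) (hWi : 1 ≤ β ⟨_, hW⟩ i) :
    ∃ x, x ∈ U ∧ x ∈ W := by
  by_contra! hcon
  have hd : Disjoint U W := disjoint_iff_inf_le.2 fun x hx => hcon x hx.1 hx.2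
  have e : clopenClass (U ⊔ W)ᶜ = K0.unit C(X, ℂ) - clopenClass U - clopenClass W := by
    rw [← clopenClass_top, ← sup_compl_eq_top (x := U ⊔ W), clopenClass_sup disjoint_compl_right,
      clopenClass_sup hd]
    abel
  have := hβ (⟨_, h1⟩ - ⟨_, hU⟩ - ⟨_, hW⟩)
    (by
      rw [AddSubgroup.coe_sub, AddSubgroup.coe_sub, ← e]
      exact clopenClass_mem_pos _) i
  rw [map_sub, map_sub, hβ1] at this
  simp only [Pi.sub_apply] at this
  omega

end Clopen

/-! ### Order automorphisms of `ℤᵈ` -/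

namespace OAutZ

variable {d : ℕ}

/-- Automorphisms of the ordered group `ℤᵈ` permute coordinates: the images of the unit vectors are
nonnegative with sum `(1, …, 1)`, so exactly one of them is nonzero at a given coordinate. -/
theorem exists_apply_eq (τ : OAutZ d) (j : Fin d) : ∃ i, ∀ x, τ x j = x i := by
  have hnn : ∀ i, 0 ≤ τ (Pi.single i 1) j := fun i => by
    have : τ (Pi.single i 1) ∈ {x : Fin d → ℤ | ∀ i, 0 ≤ x i} := by
      refine τ.2.1.subset ⟨_, fun k => ?_, rfl⟩
      by_cases hk : k = i
      · subst hk; simp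
      · simp [hk]
    exact this j
  have hexp : ∀ x, τ x j = ∑ i, x i * τ (Pi.single i 1) j := fun x => by
    have hx : x = ∑ i, x i • (Pi.single i 1 : Fin d → ℤ) := by
      ext k
      simp [Finset.sum_apply, Pi.single_apply]
    conv_lhs => rw [hx]
    rw [map_sum, Finset.sum_apply]
    simp only [map_zsmul, Pi.smul_apply, smul_eq_mul]
  have hsum : ∑ i, τ (Pi.single i 1) j = 1 := by
    have := hexp (fun _ => 1)
    rw [τ.2.2] at this
    simpa using this.symm
  obtain ⟨i, -, hi⟩ : ∃ i ∈ Finset.univ, τ (Pi.single i 1) j ≠ 0 :=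
    Finset.exists_ne_zero_of_sum_ne_zero (by rw [hsum]; exact one_ne_zero)
  have hi1 : 1 ≤ τ (Pi.single i 1) j := by have := hnn i; omega
  have hrest := Finset.add_sum_erase Finset.univ (fun i => τ (Pi.single i 1) j) (Finset.mem_univ i)
  rw [hsum] at hrest
  have hr0 : 0 ≤ ∑ k ∈ Finset.univ.erase i, τ (Pi.single k 1) j :=
    Finset.sum_nonneg fun k _ => hnn k
  have hr := (Finset.sum_eq_zero_iff_of_nonneg fun k _ => hnn k).1 (by omega :
    ∑ k ∈ Finset.univ.erase i, τ (Pi.single k 1) j = 0)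
  refine ⟨i, fun x => ?_⟩
  rw [hexp, Finset.sum_eq_single i]
  · rw [show τ (Pi.single i 1) j = 1 by omega, mul_one]
  · intro k _ hk
    rw [hr k (by simp [hk]), mul_zero]
  · simp

/-- The coordinate map of an automorphism `τ` of the ordered group `ℤᵈ`:
`τ x j = x (coord τ j)`. -/
noncomputable def coord (τ : OAutZ d) (j : Fin d) : Fin d := (exists_apply_eq τ j).choose

theorem apply_eq (τ : OAutZ d) (x : Fin d → ℤ) (j : Fin d) : τ x j = x (coord τ j) :=
  (exists_apply_eq τ j).choose_spec x

theorem coord_eq_of_forall {τ : OAutZ d} {i j : Fin d} (h : ∀ x, τ x j = x i) : coord τ j = i := by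
  have := (apply_eq τ (Pi.single i 1) j).symm.trans (h _)
  by_contra hne
  simp [hne] at this

theorem coord_one (j : Fin d) : coord (1 : OAutZ d) j = j :=
  coord_eq_of_forall fun x => by rw [OAut.one_apply]

theorem coord_mul (τ ρ : OAutZ d) (j : Fin d) : coord (τ * ρ) j = coord ρ (coord τ j) :=
  coord_eq_of_forall fun x => by rw [OAut.mul_apply, apply_eq, apply_eq]

/-- The permutation of the unit vectors underlying an automorphism of the ordered group `ℤᵈ`. It
is the inverse of the coordinate map, which is an antihomomorphism. -/
noncomputable def toPerm : OAutZ d →* Equiv.Perm (Fin d) :=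
  MonoidHom.mk' (fun τ =>
    { toFun := coord τ⁻¹
      invFun := coord τ
      left_inv := fun j => by rw [← coord_mul, inv_mul_cancel, coord_one]
      right_inv := fun j => by rw [← coord_mul, mul_inv_cancel, coord_one] })
    (fun τ ρ => by
      ext1 j
      change coord (τ * ρ)⁻¹ j = coord τ⁻¹ (coord ρ⁻¹ j)
      rw [_root_.mul_inv_rev, coord_mul])

theorem apply_toPerm (τ : OAutZ d) (x : Fin d → ℤ) (j : Fin d) : τ x (toPerm τ j) = x j := by
  rw [apply_eq]
  congr 1
  exact (toPerm τ).symm_apply_apply j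

/-- A permutation of the coordinates as an automorphism of the ordered group `ℤᵈ`. -/
def ofPerm : Equiv.Perm (Fin d) →* OAutZ d :=
  MonoidHom.mk' (fun π =>
    ⟨{ toFun := fun x i => x (π.symm i)
       invFun := fun x i => x (π i)
       left_inv := fun x => by ext; simp
       right_inv := fun x => by ext; simp
       map_add' := fun _ _ => rfl },
      Set.Subset.antisymm (by rintro _ ⟨x, hx, rfl⟩ i; exact hx _)
        (fun x hx => ⟨fun i => x (π i), fun i => hx _, by ext; simp⟩), rfl⟩)
    (fun _ _ => rfl)

end OAutZ

end KTheory

/-! ### Finite models and maps into `ℤᵈ` -/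

namespace TopDyn

open KTheory TopologicalSpace

/-- Residual finiteness gives positive unital maps `K₀(C(X)) → ℤᵈ`: the ranks at the points of a
finite model `ζ : E → X`, with `Γ` permuting the coordinates as it permutes `E`. -/
theorem IsResiduallyFinite.exists_hom {Γ : Type*} [Group Γ] {X : Type*} [MetricSpace X]
    [CompactSpace X] {h : Γ →* (X ≃ₜ X)} (hres : IsResiduallyFinite h)
    (S : Finset (K0 C(X, ℂ))) (F : Finset Γ) (hS : ∀ g ∈ S, g ∈ K0.pos C(X, ℂ)) :
    ∃ (d : ℕ) (σ : Γ →* OAutZ d) (β : K0 C(X, ℂ) →+ (Fin d → ℤ)),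
      (∀ g ∈ K0.pos C(X, ℂ), ∀ i, 0 ≤ β g i) ∧
      (β (K0.unit C(X, ℂ)) = fun _ => 1) ∧
      (∀ g ∈ S, ∀ t ∈ F, β (K0.hat (inducedAction h) t g) = σ t (β g)) ∧
      (∀ g ∈ S, g ≠ 0 → β g ≠ 0) := by
  classical
  obtain ⟨ε, hε, hrank⟩ := K0.exists_rankAt_eq_of_dist_lt S
  -- The induced action precomposes with `h t⁻¹`, whence the inverses of the elements of `F`.
  obtain ⟨E, _, k, ζ, hequi, hdense⟩ := hres ε hε (F.image fun t => t⁻¹)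
  obtain ⟨d, ⟨e⟩⟩ := Finite.exists_equiv_fin E
  refine ⟨d, OAutZ.ofPerm.comp (e.permCongrHom.toMonoidHom.comp k),
    AddMonoidHom.pi fun i => K0.rankAt (ζ (e.symm i)), ?_, ?_, ?_, ?_⟩
  · intro g hg i
    exact K0.rankAt_nonneg hg _
  · ext i
    exact K0.rankAt_unit _
  · intro g hg t ht
    ext i
    have h1 : (e.permCongrHom (k t)).symm i = e (k t⁻¹ (e.symm i)) := by
      rw [map_inv]
      rfl
    change K0.rankAt (ζ (e.symm i)) (K0.hat (inducedAction h) t g) =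
      K0.rankAt (ζ (e.symm ((e.permCongrHom (k t)).symm i))) g
    rw [K0.rankAt_hat, h1, e.symm_apply_apply]
    exact (hrank g hg _ _ (hequi t⁻¹ (Finset.mem_image_of_mem _ ht) _)).symm
  · intro g hg hg0 h0
    refine hg0 (K0.eq_zero_of_rankAt_eq_zero (hS g hg) fun x => ?_)
    obtain ⟨z, hz⟩ := hdense x
    rw [hrank g hg _ _ hz]
    have := congrFun h0 (e z)
    rwa [AddMonoidHom.pi_apply, e.symm_apply_apply] at this

/-- Partially defined positive unital maps into `ℤᵈ` that are equivariant on a fine clopen partition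
provide finite models of the action. -/
theorem isResiduallyFinite_of_exists_hom {Γ : Type*} [Group Γ] {X : Type*} [MetricSpace X]
    [CompactSpace X] [TotallyDisconnectedSpace X] {h : Γ →* (X ≃ₜ X)}
    (hyp : ∀ (S : Finset (K0 C(X, ℂ))) (F : Finset Γ), (∀ g ∈ S, g ∈ K0.pos C(X, ℂ)) →
      ∃ (d : ℕ) (H : AddSubgroup (K0 C(X, ℂ))) (σ : Γ →* OAutZ d)
        (β : H →+ (Fin d → ℤ)) (h1 : K0.unit C(X, ℂ) ∈ H)
        (hS : iterates (K0.hat (inducedAction h)) S F ⊆ H),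
        (∀ g : H, (g : K0 C(X, ℂ)) ∈ K0.pos C(X, ℂ) → ∀ i, 0 ≤ β g i) ∧
        (β ⟨K0.unit C(X, ℂ), h1⟩ = fun _ => 1) ∧
        (∀ (g : K0 C(X, ℂ)) (hg : g ∈ S) (t : Γ) (ht : t ∈ F),
          β ⟨K0.hat (inducedAction h) t g, hS ⟨g, hg, t, Or.inl ht, rfl⟩⟩ =
            σ t (β ⟨g, hS ⟨g, hg, 1, Or.inr rfl, by rw [map_one]; rfl⟩⟩)) ∧
        (∀ (g : K0 C(X, ℂ)) (hg : g ∈ S), g ≠ 0 →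
          β ⟨g, hS ⟨g, hg, 1, Or.inr rfl, by rw [map_one]; rfl⟩⟩ ≠ 0)) :
    IsResiduallyFinite h := by
  classical
  intro ε hε F
  -- A clopen partition whose members and their translates by `F` have diameter below `ε / 2`.
  let f : C(X, X × (F → X)) :=
    ⟨fun x => (x, fun s => h s x),
      continuous_id.prodMk (continuous_pi fun s => (h (s : Γ)).continuous)⟩
  have hnhds : {p : (X × (F → X)) × (X × (F → X)) | dist p.1 p.2 < ε / 2} ∈
      nhdsSet (Set.diagonal (X × (F → X))) := by
    refine IsOpen.mem_nhdsSet (isOpen_lt continuous_dist continuous_const) |>.2 ?_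
    rintro ⟨a, b⟩ (rfl : a = b)
    simpa using hε
  obtain ⟨n, W, hW0, hWd, hWc, hWdisj⟩ :=
    f.exists_disjoint_nonempty_clopen_cover_of_mem_nhds_diagonal hnhds
  have hsmall : ∀ j, ∀ y ∈ W j, ∀ z ∈ W j, dist y z < ε / 2 := fun j y hy z hz =>
    (le_max_left _ _).trans_lt (hWd j y hy z hz)
  have hsmall' : ∀ j, ∀ y ∈ W j, ∀ z ∈ W j, ∀ s ∈ F, dist (h s y) (h s z) < ε / 2 :=
    fun j y hy z hz s hs => ((dist_le_pi_dist (f y).2 (f z).2 ⟨s, hs⟩).trans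
      (le_max_right _ _)).trans_lt (hWd j y hy z hz)
  obtain ⟨d, H, σ, β, h1, hS, hpos, hone, hequi, hne⟩ :=
    hyp (Finset.univ.image fun j => clopenClass (W j)) F (by
      intro g hg
      obtain ⟨j, -, rfl⟩ := Finset.mem_image.1 hg
      exact clopenClass_mem_pos _)
  have hmem : ∀ j, clopenClass (W j) ∈ Finset.univ.image fun j => clopenClass (W j) :=
    fun j => Finset.mem_image_of_mem _ (Finset.mem_univ j)
  have hH : ∀ j, clopenClass (W j) ∈ H := fun j =>
    hS ⟨_, hmem j, 1, Or.inr rfl, by rw [map_one]; rfl⟩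
  have hsum : ∑ j, clopenClass (W j) = K0.unit C(X, ℂ) := by
    rw [sum_clopenClass _ _ hWdisj, ← clopenClass_top]
    congr 1
    refine eq_top_iff.2 fun x _ => ?_
    obtain ⟨j, hj⟩ := Set.mem_iUnion.1 (hWc (Set.mem_univ x))
    exact (Finset.le_sup (f := W) (Finset.mem_univ j)) hj
  -- The values `β [W j]` add up to `(1, …, 1)`, so every coordinate is charged by some `W j`.
  have hex : ∀ i : Fin d, ∃ j, 1 ≤ β ⟨_, hH j⟩ i := by
    intro i
    by_contra! hcon
    have h2 : ∑ j, β ⟨_, hH j⟩ i = 1 := by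
      rw [← Finset.sum_apply, ← map_sum]
      have : ∑ j, (⟨_, hH j⟩ : H) = ⟨_, h1⟩ := by
        ext
        rw [AddSubgroup.val_finsetSum]
        exact hsum
      rw [this, hone]
    have h3 : ∑ j, β ⟨_, hH j⟩ i ≤ 0 := Finset.sum_nonpos fun j _ => by
      have := hcon j
      omega
    omega
  choose c hc using hex
  have hpt : ∀ j, ∃ x, x ∈ W j := fun j => by
    by_contra! hcon
    exact hW0 j (eq_bot_iff.2 fun x hx => hcon x hx)
  choose w hw using hpt
  refine ⟨Fin d, inferInstance, OAutZ.toPerm.comp σ, fun i => w (c i), ?_, ?_⟩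
  · intro s hs i
    have hk : (OAutZ.toPerm.comp σ) s i = OAutZ.toPerm (σ s) i := rfl
    rw [hk]
    set i' := OAutZ.toPerm (σ s) i with hi'
    have hsH : K0.hat (inducedAction h) s (clopenClass (W (c i))) ∈ H :=
      hS ⟨_, hmem _, s, Or.inl hs, rfl⟩
    have hval : 1 ≤ β ⟨_, hsH⟩ i' := by
      rw [hequi _ (hmem _) s hs, hi', OAutZ.apply_toPerm]
      exact hc i
    simp only [hat_clopenClass] at hsH hval
    obtain ⟨x, hx1, hx2⟩ := exists_mem_inter_of_one_le h1 hpos hone (hH (c i')) hsH (hc i') hval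
    have e : h s (h s⁻¹ x) = x := by
      rw [map_inv]
      exact (h s).apply_symm_apply x
    have d1 := hsmall _ _ (hw (c i')) x hx1
    have d2 := hsmall' _ _ hx2 _ (hw (c i)) s hs
    rw [e] at d2
    linarith [dist_triangle (w (c i')) x (h s (w (c i)))]
  · intro x
    obtain ⟨j, hj⟩ := Set.mem_iUnion.1 (hWc (Set.mem_univ x))
    have hj0 := hne _ (hmem j) (clopenClass_ne_zero (hW0 j))
    obtain ⟨i, hi⟩ := Function.ne_iff.1 hj0
    have hi1 : 1 ≤ β ⟨_, hH j⟩ i := by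
      have := hpos ⟨_, hH j⟩ (clopenClass_mem_pos _) i
      exact lt_of_le_of_ne this (Ne.symm hi)
    obtain ⟨y, hy1, hy2⟩ := exists_mem_inter_of_one_le h1 hpos hone (hH j) (hH (c i)) hi1 (hc i)
    refine ⟨i, ?_⟩
    linarith [dist_triangle x y (w (c i)), hsmall _ _ hj _ hy1, hsmall _ _ hy2 _ (hw (c i))]

end TopDyn

theorem mainTheorem11 {Γ : Type*} [Group Γ] {X : Type*} [MetricSpace X] [CompactSpace X]
    (hX : TopologicalSpace.IsTopologicalBasis {U : Set X | IsClopen U})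
    (h : Γ →* (X ≃ₜ X)) :
    List.TFAE [
      TopDyn.IsResiduallyFinite h,
      ∀ (S : Finset (KTheory.K0 C(X, ℂ))) (F : Finset Γ), (∀ g ∈ S, g ∈ KTheory.K0.pos C(X, ℂ)) →
        ∃ (d : ℕ) (σ : Γ →* KTheory.OAutZ d) (β : KTheory.K0 C(X, ℂ) →+ (Fin d → ℤ)),
          (∀ g ∈ KTheory.K0.pos C(X, ℂ), ∀ i, 0 ≤ β g i) ∧
          (β (KTheory.K0.unit C(X, ℂ)) = fun _ => 1) ∧
          (∀ g ∈ S, ∀ t ∈ F,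
            β (KTheory.K0.hat (TopDyn.inducedAction h) t g) =
              σ t (β g)) ∧
          (∀ g ∈ S, g ≠ 0 → β g ≠ 0),
      ∀ (S : Finset (KTheory.K0 C(X, ℂ))) (F : Finset Γ), (∀ g ∈ S, g ∈ KTheory.K0.pos C(X, ℂ)) →
        ∃ (d : ℕ) (H : AddSubgroup (KTheory.K0 C(X, ℂ))) (σ : Γ →* KTheory.OAutZ d)
          (β : H →+ (Fin d → ℤ)) (h1 : KTheory.K0.unit C(X, ℂ) ∈ H)
          (hS : KTheory.iterates (KTheory.K0.hat (TopDyn.inducedAction h)) S F ⊆ H),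
          (∀ g : H, (g : KTheory.K0 C(X, ℂ)) ∈ KTheory.K0.pos C(X, ℂ) → ∀ i, 0 ≤ β g i) ∧
          (β ⟨KTheory.K0.unit C(X, ℂ), h1⟩ = fun _ => 1) ∧
          (∀ (g : KTheory.K0 C(X, ℂ)) (hg : g ∈ S) (t : Γ) (ht : t ∈ F),
            β ⟨KTheory.K0.hat (TopDyn.inducedAction h) t g,
                hS ⟨g, hg, t, Or.inl ht, rfl⟩⟩ =
              σ t (β ⟨g, hS ⟨g, hg, 1, Or.inr rfl, by rw [map_one]; rfl⟩⟩)) ∧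
          (∀ (g : KTheory.K0 C(X, ℂ)) (hg : g ∈ S), g ≠ 0 →
            β ⟨g, hS ⟨g, hg, 1, Or.inr rfl, by rw [map_one]; rfl⟩⟩ ≠ 0)] := by
  have : TotallySeparatedSpace X := totallySeparatedSpace_of_t0_of_basis_clopen hX
  tfae_have 1 → 2 := fun hres S F hS => hres.exists_hom S F hS
  tfae_have 2 → 3 := by
    intro H S F hS
    obtain ⟨d, σ, β, hpos, hone, hequi, hne⟩ := H S F hS
    exact ⟨d, ⊤, σ, β.comp (AddSubgroup.subtype ⊤), trivial, fun _ _ => trivial,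
      fun g hg => hpos g hg, hone, fun g hg t ht => hequi g hg t ht, fun g hg => hne g hg⟩
  tfae_have 3 → 1 := TopDyn.isResiduallyFinite_of_exists_hom
  tfae_finish
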